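/- Let $L$ be a frame, and let $\mathsf{S}(L)$ be the coframe of its sublocales (subsets $S\subseteq L$ closed under arbitrary meets and such that $a\to s\in S$ for all $a\in L$, $s\in S$), ordered by inclusion. For $x\in L$ let $\mathfrak{o}(x)=\{b\in L\mid x\to b=b\}$ be the open sublocale of $x$, and for $S\in\mathsf{S}(L)$ let $\mathit{fit}(S)=\bigcap\{\mathfrak{o}(x)\mid x\in L,\ S\subseteq\mathfrak{o}(x)\}$; for $\mathcal{D}\subseteq\mathsf{S}(L)$ write $\mathit{fit}[\mathcal{D}]=\{\mathit{fit}(D)\mid D\in\mathcal{D}\}$. Let $\mathsf{S}_b(L)$ be the collection of all joins in $\mathsf{S}(L)$ of complemented sublocales. A meet $\bigwedge_i x_i$ in a frame is exact if $(\bigwedge_i x_i)\vee y=\bigwedge_i(x_i\vee y)$ for all $y$; a frame homomorphism $f$ is exact if, whenever $\bigwedge_i x_i$ is an exact meet, $\bigwedge_i f(x_i)$ is exact and equals $f(\bigwedge_i x_i)$. Let $\mathsf{S}_{\mathcal{E}}(L)$ be the collection of exact sublocales, that is, of those $S\in\mathsf{S}(L)$ whose frame surjection $L\to S$, $a\mapsto\bigwedge\{s\in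 S\mid a\le s\}$, is exact. A subcolocale of a coframe $C$ is a subset $D\subseteq C$ closed under arbitrary joins and such that $d\setminus c=\bigwedge\{z\in C\mid d\le c\vee z\}\in D$ for all $d\in D$, $c\in C$; it is codense if $1\in D$. A codense subcolocale $\mathcal{D}\subseteq\mathsf{S}(L)$ is essential if it is the smallest subcolocale of $\mathsf{S}(L)$ containing all the meets, computed in $\mathcal{D}$, of families of open sublocales, i.e. all the sublocales $\bigvee\{D\in\mathcal{D}\mid D\subseteq\bigcap_i\mathfrak{o}(x_i)\}$ for families $(x_i)_i$ in $L$. Then: (1) for every frame $L$, $\mathit{fit}[\mathsf{S}_b(L)]=\mathit{fit}[\mathsf{S}_{\mathcal{E}}(L)]$; (2) there is a frame $L$ such that the map $\mathcal{D}\mapsto\mathit{fit}[\mathcal{D}]$ is not injective on the codense subcolocales of $\mathsf{S}(L)$, and such that $\mathsf{S}_{\mathcal{E}}(L)$ is a codense subcolocale of $\mathsf{S}(L)$ which is not essential. -/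

import Mathlib

namespace PointfreeFit

section Sublocales

variable {L : Type*} [Order.Frame L]

/-- The open sublocale `𝔬(a) = {b | a ⇨ b = b}`. -/
def openSublocale (a : L) : Sublocale L where
  carrier := {b | a ⇨ b = b}
  sInf_mem' s hs := by
    refine le_antisymm (le_sInf fun b hb => ?_) le_himp
    have h : a ⇨ b = b := hs hb
    exact (himp_le_himp_left (sInf_le hb)).trans h.le
  himp_mem' c b hb := by
    have h : a ⇨ b = b := hb
    change a ⇨ (c ⇨ b) = c ⇨ b
    rw [himp_left_comm, h]

/-- The fitting of a sublocale: the intersection (the meet in the coframe `Sublocale L`) of all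
open sublocales containing it. -/
def fit (S : Sublocale L) : Sublocale L :=
  sInf {T | ∃ x : L, T = openSublocale x ∧ S ≤ T}

/-- The meet of `A` is exact: it distributes over binary joins. -/
def IsExactMeet (A : Set L) : Prop :=
  ∀ y : L, sInf A ⊔ y = ⨅ x ∈ A, x ⊔ y

/-- A frame homomorphism is exact if it sends exact meets to exact meets and preserves them. -/
def IsExactHom {M : Type*} [Order.Frame M] (f : FrameHom L M) : Prop :=
  ∀ A : Set L, IsExactMeet A → IsExactMeet (f '' A) ∧ sInf (f '' A) = f (sInf A)

/-- A sublocale is exact if the associated frame surjection `L → S` is exact. -/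
def IsExactSublocale (S : Sublocale L) : Prop :=
  IsExactHom S.restrict

variable (L) in
/-- `S_b(L)`: the joins of complemented sublocales. -/
def joinsOfComplemented : Set (Sublocale L) :=
  {S | ∃ C : Set (Sublocale L), (∀ T ∈ C, IsComplemented T) ∧ S = sSup C}

variable (L) in
/-- `S_E(L)`: the exact sublocales. -/
def exactSublocales : Set (Sublocale L) :=
  {S | IsExactSublocale S}

end Sublocales

section Subcolocales

variable {C : Type*} [Order.Coframe C]

/-- A subcolocale of a coframe: a subset closed under all joins and under `d ↦ d \ c` for every
`c` in the coframe, where `\` is the co-Heyting difference. -/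
structure IsSubcolocale (D : Set C) : Prop where
  sSup_mem : ∀ A ⊆ D, sSup A ∈ D
  sdiff_mem : ∀ d ∈ D, ∀ c : C, d \ c ∈ D

/-- A subcolocale is codense if it contains the top element. -/
def IsCodenseSubcolocale (D : Set C) : Prop :=
  IsSubcolocale D ∧ ⊤ ∈ D

/-- The conucleus (interior operator) of a subcolocale. -/
def conucleus (D : Set C) (c : C) : C :=
  sSup {d | d ∈ D ∧ d ≤ c}

/-- The smallest subcolocale containing `X`. -/
def generatedSubcolocale (X : Set C) : Set C :=
  ⋂₀ {D | IsSubcolocale D ∧ X ⊆ D}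

end Subcolocales

section Essential

variable {L : Type*} [Order.Frame L]

/-- The saturated elements of `D ⊆ S(L)`: the meets, computed in `D`, of families of open
sublocales. -/
def saturated (D : Set (Sublocale L)) : Set (Sublocale L) :=
  {S | ∃ A : Set L, S = conucleus D (sInf (openSublocale '' A))}

/-- A codense subcolocale `D ⊆ S(L)` is essential if it is generated by its saturated elements. -/
def IsEssential (D : Set (Sublocale L)) : Prop :=
  D = generatedSubcolocale (saturated D)

end Essential

end PointfreeFit

namespace PointfreeFit

/-! ### Nuclei, locally closed sublocales, supplements and exactness -/

section Sublocales

variable {L : Type*} [Order.Frame L] {S T : Sublocale L} {a b x y : L}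

/-! Joins of complemented sublocales are supplements `⊤ \ T`, hence joins of locally closed
sublocales; the nucleus `x ↦ b ⇨ (a ⊔ x)` of such a sublocale preserves exact meets, and joins keep
exactness, so they are all exact. Conversely, for exact `S` the filter of `x` with `S ≤
openSublocale x` is closed under exact meets, which makes the supplement of the join of the
`closedSublocale x` lie in the same opens as `S`, so it has the same fitting
(`exists_joinsOfComplemented_fit_eq`). For (2), in a chain all meets are exact, the exact sublocales
form a subcolocale, and their saturated elements are open. Both failures thus reduce to an exact
sublocale that is not a join of complemented ones: the closed lower sets of `ℝ`, which contain no
half-open interval of the chain `LowerSet ℝ`. -/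

theorem toNucleus_mem (S : Sublocale L) (x : L) : S.toNucleus x ∈ S :=
  (S.restrict x).2

theorem toNucleus_eq_self (hx : x ∈ S) : S.toNucleus x = x := by
  rw [Sublocale.toNucleus_apply, Sublocale.restrict_of_mem hx]

theorem toNucleus_le_of_mem (hy : y ∈ S) (h : x ≤ y) : S.toNucleus x ≤ y :=
  (S.toNucleus.monotone h).trans (toNucleus_eq_self hy).le

theorem mem_of_toNucleus_le (h : S.toNucleus x ≤ x) : x ∈ S :=
  le_antisymm h S.toNucleus.le_apply ▸ toNucleus_mem S x

theorem toNucleus_sSup (C : Set (Sublocale L)) (x : L) :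
    (sSup C).toNucleus x = ⨅ T ∈ C, T.toNucleus x := by
  refine le_antisymm (le_iInf₂ fun T hT => ?_) ?_
  · exact Sublocale.toNucleus_le_toNucleus.2 (le_sSup hT) x
  · have h : sSup C ≤ (sInf (Sublocale.toNucleus '' C)).toSublocale := by
      refine sSup_le fun T hT => ?_
      rw [← Sublocale.toNucleus_le_toNucleus]
      refine le_trans ?_ (sInf_le (Set.mem_image_of_mem _ hT))
      intro z
      exact toNucleus_le_of_mem (Nucleus.mem_toSublocale.2 ⟨z, rfl⟩) Nucleus.le_apply
    obtain ⟨y, hy⟩ := Nucleus.mem_toSublocale.1 (h (toNucleus_mem _ x))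
    rw [← hy, ← Nucleus.idempotent, hy]
    refine le_trans ?_ (Nucleus.monotone (Nucleus.le_apply (n := (sSup C).toNucleus)))
    rw [Nucleus.sInf_apply, iInf_image]

/-- The closed sublocale `𝔠(a) = ↑a`. -/
def closedSublocale (a : L) : Sublocale L where
  carrier := {b | a ≤ b}
  sInf_mem' _ hs := le_sInf fun _ hb => hs hb
  himp_mem' _ _ hb := le_trans hb le_himp

theorem mem_closedSublocale : b ∈ closedSublocale a ↔ a ≤ b := Iff.rfl

theorem mem_openSublocale : b ∈ openSublocale a ↔ a ⇨ b = b := Iff.rfl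

theorem toNucleus_closedSublocale (a x : L) : (closedSublocale a).toNucleus x = a ⊔ x :=
  le_antisymm (toNucleus_le_of_mem (mem_closedSublocale.2 le_sup_left) le_sup_right)
    (sup_le (toNucleus_mem (closedSublocale a) x) Nucleus.le_apply)

theorem isCompl_closedSublocale_openSublocale (a : L) :
    IsCompl (closedSublocale a) (openSublocale a) where
  disjoint := fun S hc ho b hb => by
    have h₁ : a ≤ b := hc hb
    have h₂ : a ⇨ b = b := ho hb
    rw [← h₂, himp_eq_top_iff.2 h₁]
    exact Sublocale.top_mem
  codisjoint := fun S hc ho x _ => by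
    have h : x = (a ⊔ x) ⊓ (a ⇨ x) := by
      rw [inf_sup_right, inf_himp, inf_eq_left.2 (le_himp : x ≤ a ⇨ x), sup_eq_right.2 inf_le_right]
    rw [h]
    exact Sublocale.inf_mem (hc (mem_closedSublocale.2 le_sup_left))
      (ho (mem_openSublocale.2 himp_idem))

theorem mem_inf_sublocale : x ∈ S ⊓ T ↔ x ∈ S ∧ x ∈ T := by
  refine ⟨fun h => ⟨(inf_le_left : S ⊓ T ≤ S) h, (inf_le_right : S ⊓ T ≤ T) h⟩, fun h => ?_⟩
  let U : Sublocale L :=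
    { carrier := {z | z ∈ S ∧ z ∈ T}
      sInf_mem' := fun s hs =>
        ⟨Sublocale.sInf_mem fun _ hz => (hs hz).1, Sublocale.sInf_mem fun _ hz => (hs hz).2⟩
      himp_mem' := fun _ _ hb => ⟨Sublocale.himp_mem hb.1, Sublocale.himp_mem hb.2⟩ }
  have hU : U ≤ S ⊓ T := le_inf (fun _ hz => hz.1) (fun _ hz => hz.2)
  exact hU (show x ∈ U from h)

theorem toNucleus_locallyClosed (a b x : L) :
    (closedSublocale a ⊓ openSublocale b).toNucleus x = b ⇨ (a ⊔ x) := by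
  refine le_antisymm (toNucleus_le_of_mem (mem_inf_sublocale.2 ⟨?_, ?_⟩) ?_) ?_
  · exact mem_closedSublocale.2 (le_sup_left.trans le_himp)
  · exact mem_openSublocale.2 himp_idem
  · exact le_sup_right.trans le_himp
  · obtain ⟨h₁, h₂⟩ := mem_inf_sublocale.1
      (toNucleus_mem (closedSublocale a ⊓ openSublocale b) x)
    rw [← mem_openSublocale.1 h₂]
    exact himp_le_himp_left (sup_le h₁ Nucleus.le_apply)

/-- Every sublocale is a meet of joins of an open and a closed sublocale. -/
theorem eq_iInf_open_sup_closed (T : Sublocale L) :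
    T = ⨅ x, openSublocale x ⊔ closedSublocale (T.toNucleus x) := by
  refine le_antisymm (le_iInf fun x t ht => ?_) fun s hs => ?_
  · have h : t = (x ⇨ t) ⊓ (T.toNucleus x ⊔ t) := by
      refine le_antisymm (le_inf le_himp le_sup_right) ?_
      rw [inf_sup_left]
      refine sup_le ?_ inf_le_right
      calc (x ⇨ t) ⊓ T.toNucleus x ≤ T.toNucleus ((x ⇨ t) ⊓ x) := by
            rw [Nucleus.map_inf]; exact inf_le_inf_right _ Nucleus.le_apply
        _ ≤ t := toNucleus_le_of_mem ht himp_inf_le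
    rw [h]
    exact Sublocale.inf_mem
      ((le_sup_left : openSublocale x ≤ _) (mem_openSublocale.2 himp_idem))
      ((le_sup_right : closedSublocale (T.toNucleus x) ≤ _)
        (mem_closedSublocale.2 le_sup_left))
  -- The index `x = s` suffices: the open part sends `s` to `⊤`, so the closed part alone must fix
  -- `s`.
  · have h := iInf_le (fun x => openSublocale x ⊔ closedSublocale (T.toNucleus x)) s hs
    refine mem_of_toNucleus_le ?_
    have h' := toNucleus_eq_self h
    rw [← sSup_pair, toNucleus_sSup, iInf_pair, toNucleus_closedSublocale] at h'
    have ho : (openSublocale s).toNucleus s = ⊤ := by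
      have := mem_openSublocale.1 (toNucleus_mem (openSublocale s) s)
      rwa [himp_eq_top_iff.2 Nucleus.le_apply, eq_comm] at this
    rw [ho, top_inf_eq] at h'
    exact le_sup_left.trans h'.le

theorem top_sdiff_eq_of_isCompl {C : Type*} [Order.Coframe C] {c d : C} (h : IsCompl c d) :
    ⊤ \ c = d := by
  rw [top_sdiff', h.hnot_eq]

theorem top_sdiff_eq_iSup_locallyClosed (T : Sublocale L) :
    ⊤ \ T = ⨆ x, closedSublocale x ⊓ openSublocale (T.toNucleus x) := by
  conv_lhs => rw [eq_iInf_open_sup_closed T]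
  rw [sdiff_iInf_eq]
  refine iSup_congr fun x => top_sdiff_eq_of_isCompl ?_
  exact (isCompl_closedSublocale_openSublocale x).symm.sup_inf
    (isCompl_closedSublocale_openSublocale _)

theorem isComplemented_locallyClosed (a b : L) :
    IsComplemented (closedSublocale a ⊓ openSublocale b) :=
  IsComplemented.inf ⟨_, isCompl_closedSublocale_openSublocale a⟩
    ⟨_, (isCompl_closedSublocale_openSublocale b).symm⟩

/-- The joins of complemented sublocales are exactly the supplements. -/
theorem mem_joinsOfComplemented_iff : S ∈ joinsOfComplemented L ↔ ∃ T, S = ⊤ \ T := by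
  constructor
  · rintro ⟨C, hC, rfl⟩
    choose! f hf using hC
    refine ⟨⨅ T : C, f T, ?_⟩
    rw [sdiff_iInf_eq, sSup_eq_iSup']
    exact iSup_congr fun T => (top_sdiff_eq_of_isCompl (hf T T.2).symm).symm
  · rintro ⟨T, rfl⟩
    refine ⟨Set.range fun x => closedSublocale x ⊓ openSublocale (T.toNucleus x), ?_, ?_⟩
    · rintro _ ⟨x, rfl⟩
      exact isComplemented_locallyClosed _ _
    · rw [sSup_range, top_sdiff_eq_iSup_locallyClosed]

theorem mem_joinsOfComplemented_of_isComplemented (h : IsComplemented S) :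
    S ∈ joinsOfComplemented L :=
  ⟨{S}, fun T hT => by rwa [Set.mem_singleton_iff.1 hT], sSup_singleton.symm⟩

variable (L) in
theorem isCodenseSubcolocale_joinsOfComplemented :
    IsCodenseSubcolocale (joinsOfComplemented L) where
  left :=
    { sSup_mem := fun A hA => by
        choose! f hf using fun S (hS : S ∈ A) => mem_joinsOfComplemented_iff.1 (hA hS)
        refine mem_joinsOfComplemented_iff.2 ⟨⨅ S : A, f S, ?_⟩
        rw [sdiff_iInf_eq, sSup_eq_iSup']
        exact iSup_congr fun S => hf S S.2
      sdiff_mem := fun d hd c => by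
        obtain ⟨T, rfl⟩ := mem_joinsOfComplemented_iff.1 hd
        exact mem_joinsOfComplemented_iff.2 ⟨T ⊔ c, sdiff_sdiff_left⟩ }
  right := mem_joinsOfComplemented_of_isComplemented isComplemented_top

theorem le_openSublocale_iff : S ≤ openSublocale x ↔ S.toNucleus x = ⊤ := by
  constructor
  · intro h
    rw [← mem_openSublocale.1 (h (toNucleus_mem S x)), himp_eq_top_iff]
    exact Nucleus.le_apply
  · intro h b hb
    refine mem_openSublocale.2 (le_antisymm ?_ le_himp)
    have h' : S.toNucleus ((x ⇨ b) ⊓ x) ≤ b := toNucleus_le_of_mem hb himp_inf_le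
    rw [Nucleus.map_inf, h, inf_top_eq] at h'
    exact Nucleus.le_apply.trans h'

theorem fit_congr (h : ∀ x, S ≤ openSublocale x ↔ T ≤ openSublocale x) : fit S = fit T := by
  unfold fit
  congr 1
  ext U
  constructor <;> rintro ⟨x, rfl, hx⟩
  exacts [⟨x, rfl, (h x).1 hx⟩, ⟨x, rfl, (h x).2 hx⟩]

theorem IsExactMeet.image_sup {A : Set L} (hA : IsExactMeet A) (y : L) :
    IsExactMeet ((· ⊔ y) '' A) := by
  intro z
  rw [sInf_image, ← hA y, sup_assoc, hA, iInf_image]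
  simp only [sup_assoc]

/-- A sublocale is exact iff its nucleus preserves exact meets. -/
theorem isExactSublocale_iff :
    IsExactSublocale S ↔
      ∀ A : Set L, IsExactMeet A → ⨅ a ∈ A, S.toNucleus a ≤ S.toNucleus (sInf A) := by
  have key : ∀ A : Set L, ((sInf (S.restrict '' A) : S) : L) = ⨅ a ∈ A, S.toNucleus a := by
    intro A
    rw [Sublocale.coe_sInf, sInf_image, iInf_image]
    rfl
  constructor
  · intro h A hA
    rw [← key, (h A hA).2]
    rfl
  · intro h A hA
    have hpres : ∀ B : Set L, IsExactMeet B → sInf (S.restrict '' B) = S.restrict (sInf B) := by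
      intro B hB
      refine le_antisymm ?_ (le_sInf ?_)
      · rw [← Subtype.coe_le_coe, key]
        exact h B hB
      · rintro _ ⟨b, hb, rfl⟩
        exact OrderHomClass.mono S.restrict (sInf_le hb)
    refine ⟨fun y => ?_, hpres A hA⟩
    have hy : S.restrict (y : L) = y := Sublocale.restrict_of_mem y.2
    rw [hpres A hA]
    conv_lhs => rw [← hy]
    -- Exactness of the image is preservation of the meet of `a ⊔ y`, which is again exact.
    rw [← map_sup, hA, ← sInf_image, ← hpres _ (hA.image_sup y), sInf_image, iInf_image,
      iInf_image]
    simp only [map_sup, hy]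

theorem sSup_mem_exactSublocales {C : Set (Sublocale L)} (hC : C ⊆ exactSublocales L) :
    sSup C ∈ exactSublocales L := by
  refine isExactSublocale_iff.2 fun A hA => ?_
  rw [toNucleus_sSup]
  refine le_iInf₂ fun T hT => le_trans ?_ (isExactSublocale_iff.1 (hC hT) A hA)
  refine iInf₂_mono fun a _ => ?_
  rw [toNucleus_sSup]
  exact iInf₂_le T hT

theorem locallyClosed_mem_exactSublocales (a b : L) :
    closedSublocale a ⊓ openSublocale b ∈ exactSublocales L := by
  refine isExactSublocale_iff.2 fun A hA => ?_
  simp only [toNucleus_locallyClosed]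
  rw [sup_comm, hA, himp_iInf_eq]
  simp only [himp_iInf_eq, sup_comm a, le_refl]

variable (L) in
theorem joinsOfComplemented_subset_exactSublocales :
    joinsOfComplemented L ⊆ exactSublocales L := by
  intro S hS
  obtain ⟨T, rfl⟩ := mem_joinsOfComplemented_iff.1 hS
  rw [top_sdiff_eq_iSup_locallyClosed]
  refine sSup_mem_exactSublocales ?_
  rintro _ ⟨x, rfl⟩
  exact locallyClosed_mem_exactSublocales _ _

/-- The filter of opens containing an exact sublocale is closed under exact meets. -/
theorem le_openSublocale_sInf (hS : S ∈ exactSublocales L) {A : Set L} (hA : IsExactMeet A)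
    (h : ∀ a ∈ A, S ≤ openSublocale a) : S ≤ openSublocale (sInf A) := by
  rw [le_openSublocale_iff, eq_top_iff]
  refine le_trans ?_ (isExactSublocale_iff.1 hS A hA)
  exact le_iInf₂ fun a ha => (le_openSublocale_iff.1 (h a ha)).ge

theorem exists_joinsOfComplemented_fit_eq (hS : S ∈ exactSublocales L) :
    ∃ T ∈ joinsOfComplemented L, fit T = fit S := by
  set C : Set (Sublocale L) := closedSublocale '' {x | S ≤ openSublocale x} with hC
  refine ⟨⊤ \ sSup C, mem_joinsOfComplemented_iff.2 ⟨_, rfl⟩, fit_congr fun y => ?_⟩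
  have hy := isCompl_closedSublocale_openSublocale y
  have hle : ⊤ \ sSup C ≤ openSublocale y ↔ closedSublocale y ≤ sSup C := by
    rw [sdiff_le_iff, sup_comm, ← sdiff_le_iff, top_sdiff_eq_of_isCompl hy.symm]
  rw [hle]
  refine ⟨fun h => ?_, fun h => le_sSup ⟨y, h, rfl⟩⟩
  -- For `z = y` this writes `y` as a meet of filter elements; the instances `z = y ⊔ w` make that
  -- meet exact.
  have hmem : ∀ z, y ≤ z → z = ⨅ x ∈ {x | S ≤ openSublocale x}, x ⊔ z := by
    intro z hz
    have := toNucleus_eq_self (h (mem_closedSublocale.2 hz))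
    rw [toNucleus_sSup, hC, iInf_image] at this
    simp only [toNucleus_closedSublocale] at this
    exact this.symm
  have hinf : sInf ((· ⊔ y) '' {x | S ≤ openSublocale x}) = y := by
    rw [sInf_image]
    exact (hmem y le_rfl).symm
  rw [← hinf]
  refine le_openSublocale_sInf hS (fun z => ?_) ?_
  · rw [hinf, iInf_image]
    simp only [sup_assoc]
    exact hmem _ le_sup_left
  · rintro _ ⟨x, hx, rfl⟩
    rw [le_openSublocale_iff, eq_top_iff, ← le_openSublocale_iff.1 hx]
    exact Nucleus.monotone le_sup_left

variable (L) in
theorem fit_image_joinsOfComplemented :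
    fit '' joinsOfComplemented L = fit '' exactSublocales L := by
  refine (Set.image_mono (joinsOfComplemented_subset_exactSublocales L)).antisymm ?_
  rintro _ ⟨S, hS, rfl⟩
  exact exists_joinsOfComplemented_fit_eq hS

end Sublocales

/-! ### Exact sublocales of a chain -/

section Chains

variable {L : Type*} [Order.Frame L] [Std.Total (α := L) (· ≤ ·)] {S T : Sublocale L} {x y : L}

theorem le_of_not_le_of_total (h : ¬ x ≤ y) : y ≤ x :=
  (total_of (· ≤ ·) x y).resolve_left h

theorem himp_eq_right_of_not_le (h : ¬ x ≤ y) : x ⇨ y = y := by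
  refine le_antisymm ?_ le_himp
  rcases total_of (· ≤ ·) (x ⇨ y) x with h' | h'
  · simpa [inf_eq_left.2 h'] using (himp_inf_le : (x ⇨ y) ⊓ x ≤ y)
  · exact absurd (by simpa [inf_eq_right.2 h'] using (himp_inf_le : (x ⇨ y) ⊓ x ≤ y)) h

/-- In a chain, every subset closed under meets is a sublocale. -/
def sublocaleOfChain (s : Set L) (hs : ∀ A ⊆ s, sInf A ∈ s) : Sublocale L where
  carrier := s
  sInf_mem' := hs
  himp_mem' a b hb := by
    by_cases h : a ≤ b
    · rw [himp_eq_top_iff.2 h, ← sInf_empty]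
      exact hs _ (Set.empty_subset _)
    · rwa [himp_eq_right_of_not_le h]

theorem mem_sublocaleOfChain {s : Set L} {hs : ∀ A ⊆ s, sInf A ∈ s} :
    x ∈ sublocaleOfChain s hs ↔ x ∈ s := Iff.rfl

theorem isExactMeet_of_total (A : Set L) : IsExactMeet A := by
  intro y
  refine le_antisymm (le_iInf₂ fun a ha => sup_le_sup_right (sInf_le ha) y) ?_
  by_cases h : ∀ a ∈ A, y ≤ a
  · refine le_trans (le_sInf fun a ha => ?_) le_sup_left
    exact (iInf₂_le a ha).trans_eq (sup_eq_left.2 (h a ha))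
  · push Not at h
    obtain ⟨a, ha, hya⟩ := h
    exact (iInf₂_le a ha).trans (sup_le (le_of_not_le_of_total hya |>.trans le_sup_right)
      le_sup_right)

/-- A sublocale of a chain is exact iff each of its elements which is a limit from above in the
chain is a limit from above in the sublocale. -/
theorem mem_exactSublocales_iff_of_total :
    S ∈ exactSublocales L ↔
      ∀ x ∈ S, sInf {y | x < y} ≤ x → sInf {s | s ∈ S ∧ x < s} ≤ x := by
  constructor
  · intro h x hx hlim
    have h' := isExactSublocale_iff.1 h _ (isExactMeet_of_total {y | x < y})
    refine le_trans (le_iInf₂ fun y hy => ?_)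
      (h'.trans ((Nucleus.monotone hlim).trans (toNucleus_eq_self hx).le))
    exact sInf_le ⟨toNucleus_mem S y, lt_of_lt_of_le hy Nucleus.le_apply⟩
  · intro h
    refine isExactSublocale_iff.2 fun A _ => ?_
    by_cases hA : ∃ a ∈ A, a ≤ S.toNucleus (sInf A)
    · obtain ⟨a, ha, hle⟩ := hA
      exact (iInf₂_le a ha).trans (toNucleus_le_of_mem (toNucleus_mem _ _) hle)
    · push Not at hA
      -- In this case `sInf A` belongs to `S` and is not attained in `A`, so the limit condition
      -- applies to it.
      have hle : S.toNucleus (sInf A) ≤ sInf A :=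
        le_sInf fun a ha => le_of_not_le_of_total (hA a ha)
      have hmem := mem_of_toNucleus_le hle
      have hlim : sInf {y | sInf A < y} ≤ sInf A := by
        refine le_sInf fun a ha => sInf_le (lt_of_le_not_ge (sInf_le ha) fun hle' => ?_)
        exact hA a ha (hle'.trans Nucleus.le_apply)
      refine le_trans (le_sInf fun s hs => ?_) ((h _ hmem hlim).trans Nucleus.le_apply)
      obtain ⟨a, ha, has⟩ : ∃ a ∈ A, ¬ s ≤ a := by
        by_contra! hcon
        exact hs.2.not_ge (le_sInf hcon)
      exact (iInf₂_le a ha).trans (toNucleus_le_of_mem hs.1 (le_of_not_le_of_total has))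

/-- The nucleus of a binary join is a minimum of two values, so in a chain one of the two sublocales
already fixes `x`. -/
theorem mem_sdiff_of_total (hS : x ∈ S) (hT : x ∉ T) : x ∈ S \ T := by
  have h : x ∈ T ⊔ S \ T := (le_sup_sdiff : S ≤ T ⊔ S \ T) hS
  have h' := toNucleus_eq_self h
  rw [← sSup_pair, toNucleus_sSup, iInf_pair] at h'
  rcases total_of (· ≤ ·) (T.toNucleus x) ((S \ T).toNucleus x) with hle | hle
  · rw [inf_eq_left.2 hle] at h'
    exact absurd (mem_of_toNucleus_le h'.le) hT
  · rw [inf_eq_right.2 hle] at h'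
    exact mem_of_toNucleus_le h'.le

theorem sInf_le_of_mem_sdiff_of_total (hx : x ∈ S \ T) :
    sInf {w | (w ∈ S ∧ w ∉ T) ∧ x ≤ w} ≤ x := by
  let W : Sublocale L := sublocaleOfChain {x | sInf {w | (w ∈ S ∧ w ∉ T) ∧ x ≤ w} ≤ x} (by
    intro A hA
    refine le_sInf fun a ha => le_trans ?_ (hA ha)
    exact sInf_le_sInf fun w hw => ⟨hw.1, (sInf_le ha).trans hw.2⟩)
  have hW : S \ T ≤ W := by
    rw [sdiff_le_iff]
    intro s hs
    by_cases hsT : s ∈ T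
    · exact (le_sup_left : T ≤ T ⊔ W) hsT
    · have hsW : s ∈ W := mem_sublocaleOfChain.2 (sInf_le ⟨⟨hs, hsT⟩, le_rfl⟩)
      exact (le_sup_right : W ≤ T ⊔ W) hsW
  exact hW hx

/-- If `x ∉ T`, no point of `T` lies in the gap from `x` up to `T.toNucleus x`, so points of `S`
close above `x` survive in `S \ T`. A point of `S \ T` outside the set difference is a limit of that
difference. -/
theorem sdiff_mem_exactSublocales_of_total (hS : S ∈ exactSublocales L) (T : Sublocale L) :
    S \ T ∈ exactSublocales L := by
  rw [mem_exactSublocales_iff_of_total] at hS ⊢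
  intro x hx hlim
  by_cases hxST : x ∈ S ∧ x ∉ T
  · have hlt : ¬ T.toNucleus x ≤ x := fun h => hxST.2 (mem_of_toNucleus_le h)
    by_contra hm
    set m := sInf {s | s ∈ S \ T ∧ x < s} with hm_def
    have hmin : ¬ m ⊓ T.toNucleus x ≤ x := by
      rcases total_of (· ≤ ·) m (T.toNucleus x) with hle | hle
      · rwa [inf_eq_left.2 hle]
      · rwa [inf_eq_right.2 hle]
    obtain ⟨s, hs, hsm⟩ : ∃ s, (s ∈ S ∧ x < s) ∧ ¬ m ⊓ T.toNucleus x ≤ s := by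
      by_contra! hcon
      exact hmin ((le_sInf fun s hs => hcon s hs).trans (hS x hxST.1 hlim))
    have hsT : s ∉ T := fun hsT =>
      hsm (inf_le_right.trans (toNucleus_le_of_mem hsT hs.2.le))
    exact hsm (inf_le_left.trans (sInf_le ⟨mem_sdiff_of_total hs.1 hsT, hs.2⟩))
  · refine le_trans (le_sInf fun w hw => sInf_le ⟨mem_sdiff_of_total hw.1.1 hw.1.2, ?_⟩)
      (sInf_le_of_mem_sdiff_of_total hx)
    exact lt_of_le_of_ne hw.2 fun h => hxST (h ▸ hw.1)

variable (L) in
theorem isCodenseSubcolocale_exactSublocales_of_total :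
    IsCodenseSubcolocale (exactSublocales L) where
  left :=
    { sSup_mem := fun _ hA => sSup_mem_exactSublocales hA
      sdiff_mem := fun _ hd c => sdiff_mem_exactSublocales_of_total hd c }
  right := joinsOfComplemented_subset_exactSublocales L
    (isCodenseSubcolocale_joinsOfComplemented L).2

variable (L) in
/-- In a chain, the meets of open sublocales computed in the exact sublocales are open. -/
theorem saturated_exactSublocales_subset_of_total :
    saturated (exactSublocales L) ⊆ joinsOfComplemented L := by
  rintro _ ⟨A, rfl⟩
  have hopen : openSublocale (sInf A) ∈ joinsOfComplemented L :=
    mem_joinsOfComplemented_of_isComplemented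
      ⟨_, (isCompl_closedSublocale_openSublocale (sInf A)).symm⟩
  suffices h : conucleus (exactSublocales L) (sInf (openSublocale '' A)) =
      openSublocale (sInf A) by rwa [h]
  refine le_antisymm (sSup_le fun D hD => ?_) (le_sSup ⟨?_, le_sInf ?_⟩)
  · exact le_openSublocale_sInf hD.1 (isExactMeet_of_total A) fun a ha =>
      hD.2.trans (sInf_le ⟨a, ha, rfl⟩)
  · exact joinsOfComplemented_subset_exactSublocales L hopen
  · rintro _ ⟨a, ha, rfl⟩
    rw [le_openSublocale_iff, eq_top_iff, ← le_openSublocale_iff.1 (le_refl (openSublocale (sInf A)))]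
    exact Nucleus.monotone (sInf_le ha)

theorem not_isEssential_exactSublocales_of_total
    (h : ¬ exactSublocales L ⊆ joinsOfComplemented L) : ¬ IsEssential (exactSublocales L) := by
  intro hess
  -- The joins of complemented sublocales are a subcolocale containing the saturated elements, hence
  -- all they generate.
  refine h (hess.le.trans (Set.sInter_subset_of_mem ⟨?_, ?_⟩))
  · exact (isCodenseSubcolocale_joinsOfComplemented L).1
  · exact saturated_exactSublocales_subset_of_total L

theorem not_injOn_fit_image_of_total (h : ¬ exactSublocales L ⊆ joinsOfComplemented L) :
    ¬ Set.InjOn (fun D : Set (Sublocale L) => fit '' D) {D | IsCodenseSubcolocale D} := by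
  intro hinj
  exact h (hinj (isCodenseSubcolocale_joinsOfComplemented L)
    (isCodenseSubcolocale_exactSublocales_of_total L) (fit_image_joinsOfComplemented L)).ge

/-- In a chain, a nontrivial join of complemented sublocales contains a half-open interval. -/
theorem exists_Ico_subset_of_total (hS : S ∈ joinsOfComplemented L) (hne : S ≠ ⊥) :
    ∃ a b : L, a < b ∧ ∀ y, a ≤ y → y < b → y ∈ S := by
  obtain ⟨T, rfl⟩ := mem_joinsOfComplemented_iff.1 hS
  by_contra! hcon
  refine hne (eq_bot_iff.2 ?_)
  conv_lhs => rw [top_sdiff_eq_iSup_locallyClosed]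
  refine iSup_le fun x => ?_
  by_cases hx : T.toNucleus x ≤ x
  · intro z hz
    obtain ⟨h₁, h₂⟩ := mem_inf_sublocale.1 hz
    rw [← mem_openSublocale.1 h₂, himp_eq_top_iff.2 (hx.trans h₁)]
    exact Sublocale.top_mem
  · obtain ⟨y, hxy, hyT, hy⟩ := hcon x (T.toNucleus x) (lt_of_le_not_ge Nucleus.le_apply hx)
    refine absurd ?_ hy
    rw [top_sdiff_eq_iSup_locallyClosed]
    exact le_iSup (fun x => closedSublocale x ⊓ openSublocale (T.toNucleus x)) x
      (mem_inf_sublocale.2 ⟨hxy, himp_eq_right_of_not_le hyT.not_ge⟩)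

end Chains

/-! ### The counterexample: closed lower sets of the real line -/

section LowerSetsReal

/-- The topologically closed lower sets of the real line, as a sublocale of all lower sets. -/
def closedLowerSets : Sublocale (LowerSet ℝ) :=
  sublocaleOfChain {s | IsClosed (s : Set ℝ)} fun A hA => by
    rw [Set.mem_ofPred_eq, LowerSet.coe_sInf]
    exact isClosed_biInter fun s hs => hA hs

theorem mem_closedLowerSets {s : LowerSet ℝ} :
    s ∈ closedLowerSets ↔ IsClosed (s : Set ℝ) := Iff.rfl

theorem closedLowerSets_mem_exactSublocales :
    closedLowerSets ∈ exactSublocales (LowerSet ℝ) := by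
  refine mem_exactSublocales_iff_of_total.2 fun s hs _ p hp => ?_
  by_contra hps
  obtain ⟨q, hqp, hq⟩ : ∃ q < p, Set.Ioc q p ⊆ (s : Set ℝ)ᶜ :=
    exists_Ioc_subset_of_mem_nhds ((mem_closedLowerSets.1 hs).isOpen_compl.mem_nhds hps)
      (exists_lt p)
  -- The closed set `Iic r` lies strictly above `s` and misses `p`.
  obtain ⟨r, hqr, hrp⟩ := exists_between hqp
  have hr : r ∉ s := hq ⟨hqr, hrp.le⟩
  have hlt : s < LowerSet.Iic r := by
    refine lt_of_le_not_ge (fun y hy => ?_) fun h => hr (h (LowerSet.mem_Iic_iff.2 le_rfl))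
    exact LowerSet.mem_Iic_iff.2 (le_of_not_gt fun hry => hr (s.lower hry.le hy))
  have := LowerSet.mem_sInf_iff.1 hp (LowerSet.Iic r)
    ⟨mem_closedLowerSets.2 (by rw [LowerSet.coe_Iic]; exact isClosed_Iic), hlt⟩
  exact hrp.not_ge (LowerSet.mem_Iic_iff.1 this)

theorem closedLowerSets_notMem_joinsOfComplemented :
    closedLowerSets ∉ joinsOfComplemented (LowerSet ℝ) := by
  intro h
  have hne : closedLowerSets ≠ ⊥ := by
    intro hbot
    have h₁ : (⊥ : LowerSet ℝ) ∈ closedLowerSets :=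
      mem_closedLowerSets.2 (by rw [LowerSet.coe_bot]; exact isClosed_empty)
    have h₂ : closedLowerSets ≤ closedSublocale ⊤ := hbot ▸ bot_le
    exact mem_closedSublocale.1 (h₂ h₁) (LowerSet.mem_top (a := (0 : ℝ)))
  obtain ⟨a, b, hab, hIco⟩ := exists_Ico_subset_of_total h hne
  obtain ⟨p, hpb, hpa⟩ := Set.not_subset.1 hab.not_ge
  have ha : IsClosed (a : Set ℝ) := hIco a le_rfl hab
  obtain ⟨q, hqp, hq⟩ : ∃ q < p, Set.Ioc q p ⊆ (a : Set ℝ)ᶜ :=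
    exists_Ioc_subset_of_mem_nhds (ha.isOpen_compl.mem_nhds hpa) (exists_lt p)
  obtain ⟨r, hqr, hrp⟩ := exists_between hqp
  have hr : r ∉ a := hq ⟨hqr, hrp.le⟩
  -- `Iio r` lies in the interval from `a` to `b`, yet is not closed.
  have hclosed : IsClosed ((LowerSet.Iio r : LowerSet ℝ) : Set ℝ) := by
    refine hIco _ (fun y hy => LowerSet.mem_Iio_iff.2 ?_) (lt_of_le_not_ge (fun y hy => ?_) ?_)
    · exact lt_of_not_ge fun hry => hr (a.lower hry hy)
    · exact b.lower ((LowerSet.mem_Iio_iff.1 hy).le.trans hrp.le) hpb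
    · exact fun hle => hrp.not_gt (LowerSet.mem_Iio_iff.1 (hle hpb))
  rw [LowerSet.coe_Iio] at hclosed
  have hmem : r ∈ closure (Set.Iio r) := by
    rw [closure_Iio]
    exact Set.self_mem_Iic
  exact lt_irrefl r (hclosed.closure_eq ▸ hmem : r ∈ Set.Iio r)

end LowerSetsReal

end PointfreeFit

theorem mainTheorem10 :
    (∀ (L : Type*) [Order.Frame L],
      PointfreeFit.fit '' PointfreeFit.joinsOfComplemented L =
        PointfreeFit.fit '' PointfreeFit.exactSublocales L) ∧
    ∃ (L : Type) (_ : Order.Frame L),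
      (¬ Set.InjOn (fun D : Set (Sublocale L) => PointfreeFit.fit '' D)
        {D | PointfreeFit.IsCodenseSubcolocale D}) ∧
      PointfreeFit.IsCodenseSubcolocale (PointfreeFit.exactSublocales L) ∧
      ¬ PointfreeFit.IsEssential (PointfreeFit.exactSublocales L) := by
  have h : ¬ PointfreeFit.exactSublocales (LowerSet ℝ) ⊆
      PointfreeFit.joinsOfComplemented (LowerSet ℝ) := fun hsub =>
    PointfreeFit.closedLowerSets_notMem_joinsOfComplemented
      (hsub PointfreeFit.closedLowerSets_mem_exactSublocales)
  exact ⟨fun L _ => PointfreeFit.fit_image_joinsOfComplemented L,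
    LowerSet ℝ, inferInstance,
    PointfreeFit.not_injOn_fit_image_of_total h,
    PointfreeFit.isCodenseSubcolocale_exactSublocales_of_total _,
    PointfreeFit.not_isEssential_exactSublocales_of_total h⟩
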